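/- Consider a free-space optical system in which a source $S$ reaches a destination $D$ through two decode-and-forward relays $R_1,R_2$. For each link $AB\in\{SR_1,R_1D,SR_2,R_2D\}$ let $\rho_{AB}>0$ be the fraction of the total optical power $P_t>0$ allocated to the link, $\bar h_{AB}>0$ its path loss coefficient, and $h^j_{AB}=\bar h_{AB}\tilde h^j_{AB}$ its channel gain in transmission slot $j$, where $\tilde h^j_{AB}$ is Gamma-Gamma distributed with parameters $\alpha_{AB},\beta_{AB}>0$, i.e. has on $(0,\infty)$ the density $$\frac{2(\alpha_{AB}\beta_{AB})^{\frac{\alpha_{AB}+\beta_{AB}}2}}{\Gamma(\alpha_{AB})\Gamma(\beta_{AB})}\,x^{\frac{\alpha_{AB}+\beta_{AB}}2-1}K_{\alpha_{AB}-\beta_{AB}}\!\left(2\sqrt{\alpha_{AB}\beta_{AB}x}\right),$$ with $K_\nu$ the modified Bessel function of the second kind. The fading coefficients $\tilde h^j_{AB}$ of all links and slots are mutually independent. The SNR of link $AB$ in slot $j$ is $\gamma^j_{AB}=\eta^2\rho_{AB}^2T_b^2P_t^2(h^j_{AB})^2/N_0$ with constants $\eta,T_b,N_0>0$, and $\gamma_i^j=\min(\gamma^j_{SR_i},\gamma^j_{R_iD})$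 is the min equivalent SNR of path $i$. Under distributed switch and stay combining (DSSC) with switching threshold $T>0$, if $R_i$ was active in slot $j-1$, then in slot $j$ the relay $R_i$ stays active when $\gamma_i^j\ge T$, and the other relay becomes active when $\gamma_i^j<T$; the initially active relay may be random, but is independent of the fading. An outage occurs in slot $j$ if the min equivalent SNR of the active path is below the threshold $\gamma_{th}>0$. Put $P_M=\frac{\eta T_bP_t}{\sqrt{N_0\gamma_{th}}}$ and $\bar T=\frac{\eta T_bP_t}{\sqrt{N_0T}}$, and for $x>0$ $$F_{h_i}(x)=1-\prod_{AB\in\{SR_i,\,R_iD\}}\left(1-\frac{1}{\Gamma(\alpha_{AB})\Gamma(\beta_{AB})}\,G_{1,3}^{2,1}\!\left[\frac{\alpha_{AB}\beta_{AB}}{\bar h_{AB}\rho_{AB}}\,x\;\middle|\;\begin{array}{c}1\\ \alpha_{AB},\beta_{AB},0\end{array}\right]\right),$$ where $G$ is Meijer's $G$-function. Then $F_{h_i}$ is on $(0,\infty)$ the cdf of the min equivalent channel gain $\min(\rho_{SR_i}h^j_{SR_i},\rho_{R_iD}h^j_{R_iD})$ of path $i$, and the steady-state outage probability of DSSC is $$P_{out}=\begin{cases}\dfrac{F_{h_1}(1/\bar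 T)F_{h_2}(1/\bar T)}{F_{h_1}(1/\bar T)+F_{h_2}(1/\bar T)}\bigl(F_{h_1}(1/P_M)+F_{h_2}(1/P_M)\bigr),&\bar T\le P_M,\\[3mm]\dfrac{F_{h_1}(1/\bar T)F_{h_2}(1/\bar T)}{F_{h_1}(1/\bar T)+F_{h_2}(1/\bar T)}\bigl(F_{h_1}(1/P_M)+F_{h_2}(1/P_M)-2\bigr)+\dfrac{F_{h_1}(1/P_M)F_{h_2}(1/\bar T)+F_{h_1}(1/\bar T)F_{h_2}(1/P_M)}{F_{h_1}(1/\bar T)+F_{h_2}(1/\bar T)},&\bar T>P_M.\end{cases}$$ That is: for every $j\ge1$ for which the active relay has the same distribution in slots $j-1$ and $j$ (slot $0$ referring to the initially active relay), the probability of outage in slot $j$ equals $P_{out}$; and for every distribution of the initially active relay, the probability of outage in slot $j$ tends to $P_{out}$ as $j\to\infty$. -/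

import Mathlib

open MeasureTheory ProbabilityTheory

namespace FSO

/-! ### Special functions -/

/-- The modified Bessel function of the second kind `K_ν(z)` for real order `ν` and real
argument `z > 0`, by the integral representation
`K_ν(z) = (1/2) (z/2)^ν ∫₀^∞ t^(-ν-1) exp(-t - z²/(4t)) dt`. -/
noncomputable def besselK (ν z : ℝ) : ℝ :=
  (1 / 2) * (z / 2) ^ ν *
    ∫ t in Set.Ioi (0 : ℝ), t ^ (-ν - 1) * Real.exp (-t - z ^ 2 / (4 * t))

/-- The Mellin-Barnes integrand of Meijer's `G`-function (without the power `z ^ s`). The upper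
parameters are `a₁` (the first `n` of them) followed by `a₂`, the lower parameters are `b₁`
(the first `m` of them) followed by `b₂`. -/
noncomputable def meijerIntegrand (a₁ a₂ b₁ b₂ : List ℂ) (s : ℂ) : ℂ :=
  ((b₁.map fun b => Complex.Gamma (b - s)).prod *
      (a₁.map fun a => Complex.Gamma (1 - a + s)).prod) /
    ((b₂.map fun b => Complex.Gamma (1 - b + s)).prod *
      (a₂.map fun a => Complex.Gamma (a - s)).prod)

/-- The vertical line `Re s = c` has all poles of `Γ(b - s)`, `b ∈ b₁`, on its right and all
poles of `Γ(1 - a + s)`, `a ∈ a₁`, on its left. -/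
def SeparatesPoles (a₁ b₁ : List ℂ) (c : ℝ) : Prop :=
  (∀ b ∈ b₁, c < b.re) ∧ ∀ a ∈ a₁, a.re - 1 < c

open Classical in
/-- Meijer's `G`-function `G_{p,q}^{m,n}[z | a₁, a₂; b₁, b₂]`, with `n`, `m` the lengths of `a₁`,
`b₁` and `p`, `q` the lengths of `a₁ ++ a₂`, `b₁ ++ b₂`: the integral
`(1 / (2πi)) ∫_L (integrand) z^s ds` along an upward vertical line `L` that separates the two
families of poles (by Cauchy's theorem it does not matter which one). The value is `0` by
convention if no vertical line separates them. -/
noncomputable def meijerG (a₁ a₂ b₁ b₂ : List ℂ) (z : ℂ) : ℂ :=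
  if h : ∃ c : ℝ, SeparatesPoles a₁ b₁ c then
    (1 / (2 * Real.pi : ℂ)) * ∫ t : ℝ,
      meijerIntegrand a₁ a₂ b₁ b₂ ((h.choose : ℂ) + t * Complex.I) *
        z ^ ((h.choose : ℂ) + t * Complex.I)
  else 0

/-! ### The Gamma-Gamma distribution -/

/-- The Gamma-Gamma probability density with parameters `α`, `β`. -/
noncomputable def gammaGammaPDF (α β x : ℝ) : ℝ :=
  if 0 < x then
    2 * (α * β) ^ ((α + β) / 2) / (Real.Gamma α * Real.Gamma β) *
      x ^ ((α + β) / 2 - 1) * besselK (α - β) (2 * √(α * β * x))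
  else 0

/-- The Gamma-Gamma distribution with parameters `α`, `β`. -/
noncomputable def gammaGammaMeasure (α β : ℝ) : Measure ℝ :=
  volume.withDensity fun x => ENNReal.ofReal (gammaGammaPDF α β x)

/-- The Meijer `G` expression
`(1 / (Γ(α) Γ(β))) G_{1,3}^{2,1}[z | 1; α, β, 0]`. -/
noncomputable def meijerCDF (α β z : ℝ) : ℂ :=
  1 / (Complex.Gamma α * Complex.Gamma β) * meijerG [1] [] [(α : ℂ), (β : ℂ)] [0] (z : ℂ)

/-! ### The two-relay system -/

/-- The two hops of the end-to-end path through a relay: source to relay, relay to destination. -/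
inductive Hop : Type
  | SR : Hop
  | RD : Hop

/-- The deterministic parameters of a two-relay system. The relays `R₁`, `R₂` are the
indices `0`, `1`. -/
structure System where
  /-- responsivity of the photodetector -/
  η : ℝ
  /-- slot duration -/
  Tb : ℝ
  /-- total optical power -/
  Pt : ℝ
  /-- the noise variance is `N0 / 2` -/
  N0 : ℝ
  /-- outage threshold SNR -/
  γth : ℝ
  /-- first Gamma-Gamma parameter of each link -/
  α : Fin 2 → Hop → ℝ
  /-- second Gamma-Gamma parameter of each link -/
  β : Fin 2 → Hop → ℝ
  /-- path loss coefficient of each link -/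
  hbar : Fin 2 → Hop → ℝ
  /-- fraction of the total optical power allocated to each link -/
  ρ : Fin 2 → Hop → ℝ
  η_pos : 0 < η
  Tb_pos : 0 < Tb
  Pt_pos : 0 < Pt
  N0_pos : 0 < N0
  γth_pos : 0 < γth
  α_pos : ∀ i l, 0 < α i l
  β_pos : ∀ i l, 0 < β i l
  hbar_pos : ∀ i l, 0 < hbar i l
  ρ_pos : ∀ i l, 0 < ρ i l

namespace System

variable (S : System)

/-- Instantaneous SNR of a link whose turbulence fading coefficient is `x`. -/
noncomputable def linkSNR (i : Fin 2) (l : Hop) (x : ℝ) : ℝ :=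
  S.η ^ 2 * S.ρ i l ^ 2 * S.Tb ^ 2 * S.Pt ^ 2 * (S.hbar i l * x) ^ 2 / S.N0

/-- Min equivalent SNR of the `i`-th path when its fading coefficients are `x`. -/
noncomputable def minSNR (i : Fin 2) (x : Hop → ℝ) : ℝ :=
  min (S.linkSNR i Hop.SR (x Hop.SR)) (S.linkSNR i Hop.RD (x Hop.RD))

/-- Min equivalent channel gain of the `i`-th path (the gains `h = hbar * x` weighted by the power
fractions) when its fading coefficients are `x`. -/
noncomputable def minGain (i : Fin 2) (x : Hop → ℝ) : ℝ :=
  min (S.ρ i Hop.SR * (S.hbar i Hop.SR * x Hop.SR)) (S.ρ i Hop.RD * (S.hbar i Hop.RD * x Hop.RD))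

/-- The relay that is active in each transmission slot under switch and stay combining with
switching threshold `T`, when `b₀` is active initially and `x i l j` is the fading coefficient of
hop `l` of path `i` in slot `j`. -/
noncomputable def active (T : ℝ) (b₀ : Fin 2) (x : Fin 2 → Hop → ℕ → ℝ) : ℕ → Fin 2
  | 0 => b₀
  | j + 1 =>
    if active T b₀ x j = 0 then
      (if T ≤ S.minSNR 0 (fun l => x 0 l (j + 1)) then 0 else 1)
    else
      (if T ≤ S.minSNR 1 (fun l => x 1 l (j + 1)) then 1 else 0)

/-- The probability that in slot `j` the min equivalent SNR of the active path is below the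
outage threshold. -/
noncomputable def outageProb {Ω : Type*} [MeasurableSpace Ω] (P : Measure Ω) (T : ℝ)
    (b₀ : Ω → Fin 2) (h : Fin 2 → Hop → ℕ → Ω → ℝ) (j : ℕ) : ℝ :=
  P.real {ω | S.minSNR (S.active T (b₀ ω) (fun i l k => h i l k ω) j)
    (fun l => h (S.active T (b₀ ω) (fun i l k => h i l k ω) j) l j ω) < S.γth}

/-- The power margin `P_M`. -/
noncomputable def powerMargin : ℝ := S.η * S.Tb * S.Pt / √(S.N0 * S.γth)

/-- The normalized switching threshold `T̄`. -/
noncomputable def Tbar (T : ℝ) : ℝ := S.η * S.Tb * S.Pt / √(S.N0 * T)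

/-- The closed-form expression `F_{h_i}(x)` for the cdf of the min equivalent channel gain of the
`i`-th path. -/
noncomputable def F (i : Fin 2) (x : ℝ) : ℂ :=
  1 - (1 - meijerCDF (S.α i Hop.SR) (S.β i Hop.SR)
          (S.α i Hop.SR * S.β i Hop.SR / (S.hbar i Hop.SR * S.ρ i Hop.SR) * x)) *
      (1 - meijerCDF (S.α i Hop.RD) (S.β i Hop.RD)
          (S.α i Hop.RD * S.β i Hop.RD / (S.hbar i Hop.RD * S.ρ i Hop.RD) * x))

/-- The closed-form expression for the outage probability of switch and stay combining with
switching threshold `T`. -/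
noncomputable def outageFormula (T : ℝ) : ℂ :=
  if S.Tbar T ≤ S.powerMargin then
    S.F 0 (1 / S.Tbar T) * S.F 1 (1 / S.Tbar T) / (S.F 0 (1 / S.Tbar T) + S.F 1 (1 / S.Tbar T)) *
      (S.F 0 (1 / S.powerMargin) + S.F 1 (1 / S.powerMargin))
  else
    S.F 0 (1 / S.Tbar T) * S.F 1 (1 / S.Tbar T) / (S.F 0 (1 / S.Tbar T) + S.F 1 (1 / S.Tbar T)) *
        (S.F 0 (1 / S.powerMargin) + S.F 1 (1 / S.powerMargin) - 2) +
      (S.F 0 (1 / S.powerMargin) * S.F 1 (1 / S.Tbar T) +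
          S.F 0 (1 / S.Tbar T) * S.F 1 (1 / S.powerMargin)) /
        (S.F 0 (1 / S.Tbar T) + S.F 1 (1 / S.Tbar T))

end System

end FSO

open Set Filter Topology

/-! ### The Mellin transform of a cdf -/

/-! Two independent facts combine: the Meijer expression is the Gamma-Gamma cdf, and the active
relay is a two-state Markov chain.

For the cdf, Fubini shows that a law on the positive reals has a cdf whose Mellin transform at `-s`
is `E[u^(-s)] / s` for `Re s > 0`, if the moment exists (`mellin_cdf`). The Gamma-Gamma moment is
`(αβ)^s Γ(α-s) Γ(β-s) / (Γ(α) Γ(β))` (`moment_gammaGammaMeasure`). Since `1/s = Γ(s)/Γ(1+s)`, Mellin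
inversion along `Re = -c` with `0 < c < min α β` is the Mellin-Barnes integral of the Meijer
function (`meijerCDF_eq`). Independence of the two hops then gives `F`.

For the chain, the relay active in slot `j` depends only on the initial relay and the fading up to
slot `j`, hence is independent of the fading in slot `j + 1` (`measureReal_active_inter`). With `p
i` the probability that the SNR of path `i` falls below `T`, the probability `q j` that the relay of
index `0` is active satisfies `q (j+1) = q j (1 - p 0) + (1 - q j) p 1`. Its fixed point is `p 1 /
(p 0 + p 1)`, and the error is multiplied by `1 - (p 0 + p 1)`, of modulus below one, in each slot.
Outage in slot `j + 1` is affine in `q j` (`outageProb_succ`), so both the stationary value and the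
limit come from the fixed point (`outageFormula_eq`). -/

theorem mellin_cdf (μ : Measure ℝ) [IsProbabilityMeasure μ] (hpos : ∀ᵐ u ∂μ, 0 < u) {s : ℂ}
    (hs : 0 < s.re) (hint : Integrable (fun u : ℝ => (u : ℂ) ^ (-s)) μ) :
    MellinConvergent (fun x => ((μ.real (Iic x) : ℝ) : ℂ)) (-s) ∧
      mellin (fun x => ((μ.real (Iic x) : ℝ) : ℂ)) (-s) = (∫ u : ℝ, (u : ℂ) ^ (-s) ∂μ) / s := by
  have hs0 : s ≠ 0 := fun h => by simp [h] at hs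
  -- Both claims are Fubini for this kernel: integrating over `u` gives the Mellin integrand of the
  -- cdf, integrating over `x` gives `u^(-s)/s`.
  set φ : ℝ × ℝ → ℂ := {p : ℝ × ℝ | p.1 ≤ p.2}.indicator (fun p => (p.2 : ℂ) ^ (-s - 1)) with hφ
  have hφ_apply : ∀ u x, φ (u, x) = (Ici u).indicator (fun x : ℝ => (x : ℂ) ^ (-s - 1)) x :=
    fun u x => rfl
  have hφ_apply' : ∀ u x, φ (u, x) = (Iic x).indicator (fun _ : ℝ => (x : ℂ) ^ (-s - 1)) u :=
    fun u x => rfl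
  have hmeas : AEStronglyMeasurable φ (μ.prod (volume.restrict (Ioi 0))) := by
    refine Measurable.aestronglyMeasurable (Measurable.indicator ?_
      (measurableSet_le measurable_fst measurable_snd))
    fun_prop
  have hre : (-s - 1).re < -1 := by simp; linarith
  have hrestr : ∀ u : ℝ, 0 < u →
      ((volume.restrict (Ioi (0 : ℝ))).restrict (Ici u)) = volume.restrict (Ici u) := by
    intro u hu
    rw [Measure.restrict_restrict measurableSet_Ici,
      inter_eq_left.2 (Ici_subset_Ioi.2 hu)]
  have hval : ∀ u : ℝ, 0 < u →
      ∫ x, φ (u, x) ∂(volume.restrict (Ioi 0)) = (u : ℂ) ^ (-s) / s := by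
    intro u hu
    simp_rw [hφ_apply]
    rw [integral_indicator measurableSet_Ici, hrestr u hu, integral_Ici_eq_integral_Ioi,
      integral_Ioi_cpow_of_lt hre hu]
    rw [sub_add_cancel, neg_div_neg_eq]
  have hnorm : ∀ u : ℝ, 0 < u →
      ∫ x, ‖φ (u, x)‖ ∂(volume.restrict (Ioi 0)) = ‖(u : ℂ) ^ (-s)‖ / s.re := by
    intro u hu
    simp_rw [hφ_apply, norm_indicator_eq_indicator_norm]
    rw [integral_indicator measurableSet_Ici, hrestr u hu, integral_Ici_eq_integral_Ioi,
      setIntegral_congr_fun (g := fun x : ℝ => x ^ (-s.re - 1)) measurableSet_Ioi,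
      integral_Ioi_rpow_of_lt (by linarith) hu, Complex.norm_cpow_eq_rpow_re_of_pos hu]
    · rw [sub_add_cancel, neg_div_neg_eq, Complex.neg_re]
    · intro x hx
      simp [Complex.norm_cpow_eq_rpow_re_of_pos (hu.trans hx)]
  have hφint : Integrable φ (μ.prod (volume.restrict (Ioi 0))) := by
    refine (integrable_prod_iff hmeas).2 ⟨?_, ?_⟩
    · filter_upwards [hpos] with u hu
      simp_rw [hφ_apply]
      rw [integrable_indicator_iff measurableSet_Ici, IntegrableOn, hrestr u hu]
      exact (integrableOn_Ici_iff_integrableOn_Ioi (by simp)).2 (integrableOn_Ioi_cpow_of_lt hre hu)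
    · refine (hint.norm.div_const s.re).congr ?_
      filter_upwards [hpos] with u hu
      exact (hnorm u hu).symm
  have hinner : ∀ x : ℝ, ∫ u, φ (u, x) ∂μ =
      (x : ℂ) ^ (-s - 1) • ((μ.real (Iic x) : ℝ) : ℂ) := by
    intro x
    simp_rw [hφ_apply']
    rw [integral_indicator measurableSet_Iic, setIntegral_const, smul_eq_mul, mul_comm]
    rfl
  refine ⟨hφint.integral_prod_right.congr (ae_of_all _ hinner), ?_⟩
  rw [mellin]
  simp_rw [← hinner]
  rw [← integral_prod_symm _ hφint, integral_prod _ hφint, ← integral_div]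
  refine integral_congr_ae ?_
  filter_upwards [hpos] with u hu
  exact hval u hu

/-- A cdf is right continuous, and its jump at a point is the mass of that point, here zero. Mellin
inversion needs this continuity. -/
theorem continuous_measureReal_Iic (μ : Measure ℝ) [IsProbabilityMeasure μ] [NullSingletonClass μ] :
    Continuous fun x => μ.real (Iic x) := by
  rw [continuous_iff_continuousAt]
  intro x
  have h := (cdf μ).measure_singleton x
  rw [measure_cdf, measure_singleton, eq_comm, ENNReal.ofReal_eq_zero, sub_nonpos] at h
  have hl : Function.leftLim (cdf μ) x = cdf μ x :=
    le_antisymm ((monotone_cdf μ).leftLim_le le_rfl) h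
  have : ContinuousAt (cdf μ) x := by
    rw [(monotone_cdf μ).continuousAt_iff_leftLim_eq_rightLim, hl, StieltjesFunction.rightLim_eq]
  exact this.congr (Eventually.of_forall fun y => cdf_eq_real μ y)

/-! ### Moments of the Gamma-Gamma kernel -/

theorem integrableOn_rpow_mul_exp_neg_mul {a b : ℝ} (ha : 0 < a) (hb : 0 < b) :
    IntegrableOn (fun x : ℝ => x ^ (a - 1) * Real.exp (-(b * x))) (Ioi 0) := by
  simpa using integrableOn_rpow_mul_exp_neg_mul_rpow (p := 1) (s := a - 1) (b := b)
    (by linarith) one_pos hb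

theorem norm_cpow_mul_gammaGammaKernel (v : ℂ) (d r : ℝ) {u t : ℝ} (hu : 0 < u) (ht : 0 < t) :
    ‖(u : ℂ) ^ (v - 1) * ((t ^ (d - 1) * Real.exp (-t - r * u / t) : ℝ) : ℂ)‖ =
      (t ^ (d - 1) * Real.exp (-t)) * (u ^ (v.re - 1) * Real.exp (-(r / t * u))) := by
  rw [norm_mul, Complex.norm_cpow_eq_rpow_re_of_pos hu, Complex.norm_real,
    Real.norm_of_nonneg (by positivity), sub_eq_add_neg (-t), Real.exp_add]
  simp only [Complex.sub_re, Complex.one_re]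
  ring_nf

/-- Tonelli with `u` integrated first: for fixed `t` the norm is a Gamma integrand of rate `r / t`,
and its integral contributes `t ^ v.re`. What remains is a Gamma integrand in `t` of exponent `v.re
+ d`, whence the two positivity conditions. -/
theorem integrable_cpow_mul_gammaGammaKernel {v : ℂ} {d r : ℝ} (hv : 0 < v.re)
    (hd : 0 < v.re + d) (hr : 0 < r) :
    Integrable (fun p : ℝ × ℝ => (p.1 : ℂ) ^ (v - 1) *
      ((p.2 ^ (d - 1) * Real.exp (-p.2 - r * p.1 / p.2) : ℝ) : ℂ))
      ((volume.restrict (Ioi 0)).prod (volume.restrict (Ioi 0))) := by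
  have hmeas : Measurable (fun p : ℝ × ℝ => (p.1 : ℂ) ^ (v - 1) *
      ((p.2 ^ (d - 1) * Real.exp (-p.2 - r * p.1 / p.2) : ℝ) : ℂ)) := by fun_prop
  refine (integrable_prod_iff' hmeas.aestronglyMeasurable).2 ⟨?_, ?_⟩
  · filter_upwards [ae_restrict_mem measurableSet_Ioi] with t (ht : 0 < t)
    refine (integrable_norm_iff (hmeas.comp measurable_prodMk_right).aestronglyMeasurable).1 ?_
    refine ((integrableOn_rpow_mul_exp_neg_mul hv (div_pos hr ht)).const_mul
      (t ^ (d - 1) * Real.exp (-t))).congr ?_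
    filter_upwards [ae_restrict_mem measurableSet_Ioi] with u (hu : 0 < u)
    exact (norm_cpow_mul_gammaGammaKernel v d r hu ht).symm
  · refine ((integrableOn_rpow_mul_exp_neg_mul hd one_pos).const_mul
      (r ^ (-v.re) * Real.Gamma v.re)).congr ?_
    filter_upwards [ae_restrict_mem measurableSet_Ioi] with t (ht : 0 < t)
    rw [setIntegral_congr_fun measurableSet_Ioi
      (fun u hu => norm_cpow_mul_gammaGammaKernel v d r hu ht), integral_const_mul,
      Real.integral_rpow_mul_exp_neg_mul_Ioi hv (div_pos hr ht), one_div_div,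
      Real.div_rpow ht.le hr.le, Real.rpow_neg hr.le,
      show v.re + d - 1 = v.re + (d - 1) by ring, Real.rpow_add ht]
    ring_nf

theorem integral_cpow_mul_gammaGammaKernel {v : ℂ} {d r : ℝ} (hv : 0 < v.re)
    (hd : 0 < v.re + d) (hr : 0 < r) :
    ∫ u in Ioi (0 : ℝ), (u : ℂ) ^ (v - 1) *
      ((∫ t in Ioi (0 : ℝ), t ^ (d - 1) * Real.exp (-t - r * u / t) : ℝ) : ℂ) =
      (r : ℂ) ^ (-v) * Complex.Gamma v * Complex.Gamma (v + d) := by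
  have hint := integrable_cpow_mul_gammaGammaKernel hv hd hr
  have hr0 : (r : ℂ) ≠ 0 := by exact_mod_cast hr.ne'
  simp_rw [← integral_complex_ofReal, ← integral_const_mul]
  rw [← integral_prod _ hint, integral_prod_symm _ hint,
    setIntegral_congr_fun (g := fun t : ℝ => ((r : ℂ) ^ (-v) * Complex.Gamma v) *
      ((t : ℂ) ^ (v + d - 1) * Complex.exp (-((1 : ℝ) * t)))) measurableSet_Ioi ?_,
    integral_const_mul, Complex.integral_cpow_mul_exp_neg_mul_Ioi (by simpa using hd) one_pos]
  · simp
  · intro t (ht : 0 < t)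
    have ht0 : (t : ℂ) ≠ 0 := by exact_mod_cast ht.ne'
    have h1 : ∀ u : ℝ, (u : ℂ) ^ (v - 1) *
        ((t ^ (d - 1) * Real.exp (-t - r * u / t) : ℝ) : ℂ) =
        ((t : ℂ) ^ ((d : ℂ) - 1) * Complex.exp (-t)) *
          ((u : ℂ) ^ (v - 1) * Complex.exp (-((r / t : ℝ) * u))) := by
      intro u
      rw [sub_eq_add_neg (-t), Real.exp_add]
      push_cast [Complex.ofReal_cpow ht.le]
      ring_nf
    simp_rw [h1]
    rw [integral_const_mul, Complex.integral_cpow_mul_exp_neg_mul_Ioi hv (div_pos hr ht)]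
    have h2 : (1 / ((r / t : ℝ) : ℂ)) ^ v = (t : ℂ) ^ v * (r : ℂ) ^ (-v) := by
      rw [show (1 / ((r / t : ℝ) : ℂ)) = ((t : ℝ) : ℂ) * ((r⁻¹ : ℝ) : ℂ) by
        push_cast; field_simp, Complex.mul_cpow_ofReal_nonneg ht.le (by positivity),
        Complex.ofReal_inv, Complex.inv_cpow _ _ (by
          rw [Complex.arg_ofReal_of_nonneg hr.le]; exact Real.pi_pos.ne), Complex.cpow_neg]
    rw [h2, show v + d - 1 = v + (d - 1) by ring, Complex.cpow_add _ _ ht0]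
    simp only [Complex.ofReal_one, one_mul]
    ring

/-- Almost every section of an integrable function is integrable. The exponent `|d| + 1` makes both
conditions of the joint integrability hold, and the nonzero power of `u` divides out. -/
theorem ae_integrableOn_gammaGammaKernel (d : ℝ) {r : ℝ} (hr : 0 < r) :
    ∀ᵐ u ∂(volume.restrict (Ioi (0 : ℝ))),
      IntegrableOn (fun t : ℝ => t ^ (d - 1) * Real.exp (-t - r * u / t)) (Ioi 0) := by
  have hint := integrable_cpow_mul_gammaGammaKernel (v := ((|d| + 1 : ℝ) : ℂ)) (d := d) (r := r)
    (by simp; positivity) (by simp; linarith [neg_abs_le d]) hr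
  filter_upwards [hint.prod_right_ae, ae_restrict_mem measurableSet_Ioi] with u hu (hu0 : 0 < u)
  have hne : (u : ℂ) ^ (((|d| + 1 : ℝ) : ℂ) - 1) ≠ 0 := by
    rw [Ne, Complex.cpow_eq_zero_iff]
    exact fun h => hu0.ne' (by exact_mod_cast h.1)
  have h := (integrable_const_mul_iff (isUnit_iff_ne_zero.2 hne) _).1 hu
  exact h.re.congr (ae_of_all _ fun t => Complex.ofReal_re _)

namespace FSO

/-! ### The Gamma-Gamma distribution -/

theorem measurable_besselK (ν : ℝ) : Measurable (besselK ν) := by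
  have h : Measurable fun z : ℝ =>
      ∫ t in Ioi (0 : ℝ), t ^ (-ν - 1) * Real.exp (-t - z ^ 2 / (4 * t)) := by
    refine StronglyMeasurable.measurable (StronglyMeasurable.integral_prod_right'
      (f := fun p : ℝ × ℝ => p.2 ^ (-ν - 1) * Real.exp (-p.2 - p.1 ^ 2 / (4 * p.2))) ?_)
    exact Measurable.stronglyMeasurable (by fun_prop)
  unfold besselK
  exact (by fun_prop : Measurable fun z : ℝ => (1 / 2) * (z / 2) ^ ν).mul h

theorem measurable_gammaGammaPDF (α β : ℝ) : Measurable (gammaGammaPDF α β) := by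
  unfold gammaGammaPDF
  refine Measurable.ite measurableSet_Ioi ?_ measurable_const
  exact (by fun_prop : Measurable fun x : ℝ =>
    2 * (α * β) ^ ((α + β) / 2) / (Real.Gamma α * Real.Gamma β) *
      x ^ ((α + β) / 2 - 1)).mul ((measurable_besselK _).comp (by fun_prop))

variable {α β : ℝ}

/-- The half-integral powers and the square root in the Bessel form merge into pure powers, leaving
the kernel above with `d = β - α` and `r = α * β`. -/
theorem gammaGammaPDF_eq (hα : 0 < α) (hβ : 0 < β) {x : ℝ} (hx : 0 < x) :
    gammaGammaPDF α β x = (α * β) ^ α / (Real.Gamma α * Real.Gamma β) * x ^ (α - 1) *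
      ∫ t in Ioi (0 : ℝ), t ^ (β - α - 1) * Real.exp (-t - α * β * x / t) := by
  have hr : 0 < α * β := mul_pos hα hβ
  have hrx : 0 < α * β * x := mul_pos hr hx
  have hk : ∀ t : ℝ, (2 * √(α * β * x)) ^ 2 / (4 * t) = α * β * x / t := by
    intro t
    rw [mul_pow, Real.sq_sqrt hrx.le, show (2 : ℝ) ^ 2 = 4 by norm_num,
      mul_div_mul_left _ _ (by norm_num)]
  have hpow : (α * β) ^ ((α + β) / 2) * x ^ ((α + β) / 2 - 1) * (√(α * β * x)) ^ (α - β) =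
      (α * β) ^ α * x ^ (α - 1) := by
    rw [Real.sqrt_eq_rpow, ← Real.rpow_mul hrx.le, Real.mul_rpow hr.le hx.le,
      mul_mul_mul_comm, ← Real.rpow_add hr, ← Real.rpow_add hx]
    ring_nf
  rw [gammaGammaPDF, if_pos hx, besselK]
  simp_rw [hk]
  rw [mul_div_cancel_left₀ _ (two_ne_zero), show -(α - β) - 1 = β - α - 1 by ring]
  generalize (∫ t in Ioi (0 : ℝ), t ^ (β - α - 1) * Real.exp (-t - α * β * x / t)) = I
  calc _ = ((α * β) ^ ((α + β) / 2) * x ^ ((α + β) / 2 - 1) * (√(α * β * x)) ^ (α - β)) /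
        (Real.Gamma α * Real.Gamma β) * I := by ring
    _ = _ := by rw [hpow]; ring

theorem gammaGammaPDF_nonneg (hα : 0 < α) (hβ : 0 < β) (x : ℝ) : 0 ≤ gammaGammaPDF α β x := by
  by_cases hx : 0 < x
  · rw [gammaGammaPDF_eq hα hβ hx]
    refine mul_nonneg (mul_nonneg (div_nonneg (by positivity)
      (mul_nonneg (Real.Gamma_pos_of_pos hα).le (Real.Gamma_pos_of_pos hβ).le))
      (by positivity)) (setIntegral_nonneg measurableSet_Ioi fun t (ht : 0 < t) => by positivity)
  · rw [gammaGammaPDF, if_neg hx]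

/-- The kernel is positive, but its Bochner integral is known to be positive only where the kernel
is integrable, hence the almost everywhere form. -/
theorem ae_gammaGammaPDF_pos (hα : 0 < α) (hβ : 0 < β) :
    ∀ᵐ x ∂(volume.restrict (Ioi (0 : ℝ))), 0 < gammaGammaPDF α β x := by
  filter_upwards [ae_integrableOn_gammaGammaKernel (β - α) (mul_pos hα hβ),
    ae_restrict_mem measurableSet_Ioi] with x hx (hx0 : 0 < x)
  rw [gammaGammaPDF_eq hα hβ hx0]
  refine mul_pos (mul_pos (div_pos (Real.rpow_pos_of_pos (mul_pos hα hβ) _)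
      (mul_pos (Real.Gamma_pos_of_pos hα) (Real.Gamma_pos_of_pos hβ)))
      (Real.rpow_pos_of_pos hx0 _)) ?_
  refine (setIntegral_pos_iff_support_of_nonneg_ae ?_ hx).2 ?_
  · filter_upwards [ae_restrict_mem measurableSet_Ioi] with t (ht : 0 < t)
    simp only [Pi.zero_apply]
    positivity
  · rw [inter_eq_right.2]
    · simp
    · intro t (ht : 0 < t)
      exact (mul_pos (Real.rpow_pos_of_pos ht _) (Real.exp_pos _)).ne'

instance : NullSingletonClass (gammaGammaMeasure α β) :=
  inferInstanceAs (NullSingletonClass (volume.withDensity _))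

theorem ae_gammaGammaMeasure_pos : ∀ᵐ u ∂(gammaGammaMeasure α β), 0 < u := by
  rw [gammaGammaMeasure, ae_withDensity_iff (measurable_gammaGammaPDF α β).ennreal_ofReal]
  refine ae_of_all _ fun x hx => ?_
  by_contra h
  simp [gammaGammaPDF, h] at hx

theorem gammaGammaMeasure_Ioc_pos (hα : 0 < α) (hβ : 0 < β) {a b : ℝ} (ha : 0 ≤ a) (hab : a < b) :
    0 < gammaGammaMeasure α β (Ioc a b) := by
  rw [pos_iff_ne_zero, Ne, gammaGammaMeasure,
    withDensity_apply_eq_zero (measurable_gammaGammaPDF α β).ennreal_ofReal]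
  intro h
  have hsub : Ioc a b ⊆ Ioi 0 := fun x hx => ha.trans_lt hx.1
  have h1 : volume (Ioc a b \ {x | ENNReal.ofReal (gammaGammaPDF α β x) ≠ 0}) = 0 := by
    have := (ae_restrict_iff' measurableSet_Ioi).1 (ae_gammaGammaPDF_pos hα hβ)
    refine measure_mono_null ?_ this
    intro x hx hx'
    exact hx.2 (by simpa using hx' (hsub hx.1))
  have h2 : volume (Ioc a b) = 0 := by
    refine measure_mono_null (fun x hx => ?_) (measure_union_null h h1)
    by_cases hx' : ENNReal.ofReal (gammaGammaPDF α β x) ≠ 0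
    · exact Or.inl ⟨hx', hx⟩
    · exact Or.inr ⟨hx, hx'⟩
  rw [Real.volume_Ioc, ENNReal.ofReal_eq_zero] at h2
  linarith

/-- This is the kernel integral at `v = α - s`, `d = β - α`, so that `v + d = β - s`. -/
theorem moment_gammaGammaMeasure (hα : 0 < α) (hβ : 0 < β) {s : ℂ} (hsα : s.re < α)
    (hsβ : s.re < β) :
    Integrable (fun u : ℝ => (u : ℂ) ^ (-s)) (gammaGammaMeasure α β) ∧
      ∫ u : ℝ, (u : ℂ) ^ (-s) ∂(gammaGammaMeasure α β) =
        ((α * β : ℝ) : ℂ) ^ s * Complex.Gamma (α - s) * Complex.Gamma (β - s) /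
          (Complex.Gamma α * Complex.Gamma β) := by
  have hr : 0 < α * β := mul_pos hα hβ
  have hv : 0 < ((α : ℂ) - s).re := by simpa using hsα
  have hd : 0 < ((α : ℂ) - s).re + (β - α) := by simp; linarith
  have hmeas : Measurable fun x => ENNReal.ofReal (gammaGammaPDF α β x) :=
    (measurable_gammaGammaPDF α β).ennreal_ofReal
  set D : ℝ := (α * β) ^ α / (Real.Gamma α * Real.Gamma β) with hD
  have hcongr : ∀ u : ℝ, u ∈ Ioi (0 : ℝ) →
      (ENNReal.ofReal (gammaGammaPDF α β u)).toReal • (u : ℂ) ^ (-s) =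
      (D : ℂ) * ((u : ℂ) ^ ((α : ℂ) - s - 1) *
        ((∫ t in Ioi (0 : ℝ), t ^ (β - α - 1) * Real.exp (-t - α * β * u / t) : ℝ) : ℂ)) := by
    intro u (hu : 0 < u)
    have hu0 : (u : ℂ) ≠ 0 := by exact_mod_cast hu.ne'
    rw [ENNReal.toReal_ofReal (gammaGammaPDF_nonneg hα hβ u), gammaGammaPDF_eq hα hβ hu, ← hD,
      show (α : ℂ) - s - 1 = ((α - 1 : ℝ) : ℂ) + (-s) by push_cast; ring,
      Complex.cpow_add _ _ hu0, ← Complex.ofReal_cpow hu.le, Complex.real_smul]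
    push_cast
    ring
  have hsupp : ∀ u : ℝ, u ∉ Ioi (0 : ℝ) →
      (ENNReal.ofReal (gammaGammaPDF α β u)).toReal • (u : ℂ) ^ (-s) = 0 := by
    intro u hu
    rw [gammaGammaPDF, if_neg (by simpa using hu)]
    simp
  constructor
  · rw [gammaGammaMeasure, integrable_withDensity_iff_integrable_smul' hmeas (by simp),
      ← integrableOn_iff_integrable_of_support_subset
        (s := Ioi (0 : ℝ)) (fun u hu => by_contra fun h => hu (hsupp u h))]
    refine IntegrableOn.congr_fun ?_ (fun u hu => (hcongr u hu).symm) measurableSet_Ioi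
    refine Integrable.const_mul ?_ _
    have h := (integrable_cpow_mul_gammaGammaKernel hv hd hr).integral_prod_left
    refine h.congr (ae_of_all _ fun u => ?_)
    simp only
    rw [integral_const_mul, integral_complex_ofReal]
  · rw [gammaGammaMeasure, integral_withDensity_eq_integral_toReal_smul hmeas (by simp),
      ← setIntegral_eq_integral_of_forall_compl_eq_zero (fun u hu => hsupp u hu),
      setIntegral_congr_fun measurableSet_Ioi hcongr, integral_const_mul,
      integral_cpow_mul_gammaGammaKernel hv hd hr, hD]
    have hr0 : ((α * β : ℝ) : ℂ) ≠ 0 := by exact_mod_cast hr.ne'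
    rw [Complex.ofReal_div, Complex.ofReal_cpow hr.le, Complex.ofReal_mul (Real.Gamma α),
      ← Complex.Gamma_ofReal, ← Complex.Gamma_ofReal, neg_sub, Complex.cpow_sub _ _ hr0,
      show (α : ℂ) - s + ((β - α : ℝ) : ℂ) = β - s by push_cast; ring]
    have : ((α * β : ℝ) : ℂ) ^ (α : ℂ) ≠ 0 := by
      rw [Ne, Complex.cpow_eq_zero_iff]; exact fun h => hr0 h.1
    field_simp

/-! ### Mellin inversion -/

theorem norm_Gamma_le {z : ℂ} (hz : 0 < z.re) : ‖Complex.Gamma z‖ ≤ Real.Gamma z.re := by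
  rw [Complex.Gamma_eq_integral hz, Real.Gamma_eq_integral hz, Complex.GammaIntegral]
  refine (norm_integral_le_integral_norm _).trans (le_of_eq ?_)
  refine setIntegral_congr_fun measurableSet_Ioi fun x (hx : 0 < x) => ?_
  simp only [norm_mul, Complex.norm_cpow_eq_rpow_re_of_pos hx, Complex.norm_real]
  rw [Real.norm_of_nonneg (Real.exp_pos _).le]
  simp

/-- From `Γ(z+1) = z Γ(z)`: the decay of order `1/|z|` on vertical lines that makes the inversion
integral converge. -/
theorem norm_Gamma_mul_norm_le {z : ℂ} (hz : 0 < z.re) :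
    ‖Complex.Gamma z‖ * ‖z‖ ≤ Real.Gamma (z.re + 1) := by
  have hz0 : z ≠ 0 := fun h => by simp [h] at hz
  have h := norm_Gamma_le (z := z + 1) (by simp; linarith)
  rw [Complex.Gamma_add_one z hz0, norm_mul] at h
  simpa [mul_comm] using h

/-- One Gamma factor is merely bounded. The other decays like `1/|α - s|`, which together with
`1/|s|` gives a bound of order `1/(1 + t²)`. -/
theorem integrable_Gamma_mul_Gamma_div {c : ℝ} (hc : 0 < c) (hcα : c < α) (hcβ : c < β) :
    Integrable (fun t : ℝ => Complex.Gamma (α - (c + t * Complex.I)) *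
      Complex.Gamma (β - (c + t * Complex.I)) / (c + t * Complex.I)) := by
  have hΓ : ∀ {a : ℝ}, c < a → Continuous fun t : ℝ => Complex.Gamma (a - (c + t * Complex.I)) := by
    intro a ha
    rw [continuous_iff_continuousAt]
    intro t
    refine ContinuousAt.comp (g := Complex.Gamma) (Complex.differentiableAt_Gamma _ ?_).continuousAt
      (by fun_prop)
    intro m hm
    have := congrArg Complex.re hm
    simp at this
    have hm0 : (0 : ℝ) ≤ m := m.cast_nonneg
    linarith
  have hne : ∀ t : ℝ, (c + t * Complex.I : ℂ) ≠ 0 := by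
    intro t h
    have := congrArg Complex.re h
    simp at this
    linarith
  have hcont : Continuous (fun t : ℝ => Complex.Gamma (α - (c + t * Complex.I)) *
      Complex.Gamma (β - (c + t * Complex.I)) / (c + t * Complex.I)) :=
    ((hΓ hcα).mul (hΓ hcβ)).div (by fun_prop) hne
  -- A lower bound for the real parts of `s` and `α - s`; the cap at `1` yields `m² (1 + t²) ≤
  -- |z|²`.
  set m : ℝ := min (min c (α - c)) 1 with hm
  have hm0 : 0 < m := lt_min (lt_min hc (by linarith)) one_pos
  have hm1 : m ≤ 1 := min_le_right _ _
  have hmc : m ≤ c := (min_le_left _ _).trans (min_le_left _ _)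
  have hmα : m ≤ α - c := (min_le_left _ _).trans (min_le_right _ _)
  refine Integrable.mono' (integrable_inv_one_add_sq.const_mul
    (Real.Gamma (α - c + 1) * Real.Gamma (β - c) * (m ^ 2)⁻¹)) hcont.aestronglyMeasurable
    (ae_of_all _ fun t => ?_)
  have hbound : ∀ z : ℂ, m ≤ z.re → z.im ^ 2 = t ^ 2 → m ^ 2 * (1 + t ^ 2) ≤ ‖z‖ ^ 2 := by
    intro z h1 h2
    rw [Complex.sq_norm, Complex.normSq_apply, ← sq, ← sq, h2]
    have h3 : m ^ 2 ≤ z.re ^ 2 := by gcongr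
    have h4 : m ^ 2 * t ^ 2 ≤ t ^ 2 :=
      mul_le_of_le_one_left (sq_nonneg t) (pow_le_one₀ hm0.le hm1)
    linarith
  have h1 := hbound (c + t * Complex.I) (by simpa using hmc) (by simp)
  have h2 := hbound (α - (c + t * Complex.I)) (by simpa using hmα) (by simp)
  have h3 := norm_Gamma_mul_norm_le (z := α - (c + t * Complex.I)) (by simpa using hcα)
  have h4 := norm_Gamma_le (z := β - (c + t * Complex.I)) (by simpa using hcβ)
  simp only [Complex.sub_re, Complex.add_re, Complex.ofReal_re, Complex.mul_re, Complex.I_re,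
    mul_zero, Complex.ofReal_im, Complex.I_im, mul_one, sub_self, add_zero] at h3 h4
  set A := ‖Complex.Gamma (α - (c + t * Complex.I))‖
  set B := ‖Complex.Gamma (β - (c + t * Complex.I))‖
  set X := ‖(c + t * Complex.I : ℂ)‖
  set Y := ‖(α - (c + t * Complex.I) : ℂ)‖
  have hX : 0 < X := norm_pos_iff.2 (hne t)
  have hXY : m ^ 2 * (1 + t ^ 2) ≤ X * Y := by
    have h0 : 0 ≤ m ^ 2 * (1 + t ^ 2) := by positivity
    refine abs_le_of_sq_le_sq' ?_ (by positivity) |>.2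
    rw [mul_pow X Y, sq (m ^ 2 * (1 + t ^ 2))]
    exact mul_le_mul h1 h2 h0 (by positivity)
  rw [norm_div, norm_mul, mul_assoc _ (m ^ 2)⁻¹, ← mul_inv, div_le_iff₀ hX,
    mul_assoc, mul_comm _ X, ← mul_assoc, ← div_eq_mul_inv, le_div_iff₀ (by positivity)]
  calc A * B * (m ^ 2 * (1 + t ^ 2)) ≤ A * B * (X * Y) := by gcongr
    _ = (A * Y) * B * X := by ring
    _ ≤ Real.Gamma (α - c + 1) * Real.Gamma (β - c) * X := by gcongr

theorem meijerCDF_eq (hα : 0 < α) (hβ : 0 < β) [IsProbabilityMeasure (gammaGammaMeasure α β)]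
    {x : ℝ} (hx : 0 < x) :
    meijerCDF α β (α * β * x) = (((gammaGammaMeasure α β).real (Iic x) : ℝ) : ℂ) := by
  have hr : 0 < α * β := mul_pos hα hβ
  have hex : ∃ c : ℝ, SeparatesPoles [1] [(α : ℂ), (β : ℂ)] c := by
    refine ⟨min α β / 2, ?_⟩
    have : 0 < min α β := lt_min hα hβ
    simp only [SeparatesPoles, List.mem_cons, List.not_mem_nil, or_false, forall_eq_or_imp,
      forall_eq, Complex.ofReal_re, Complex.one_re, sub_self]
    exact ⟨⟨by linarith [min_le_left α β], by linarith [min_le_right α β]⟩, by linarith⟩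
  have hc := hex.choose_spec
  rw [meijerCDF, meijerG, dif_pos hex]
  -- The line is whichever one the definition picks; only `0 < c < min α β` is used.
  set c := hex.choose
  simp only [SeparatesPoles, List.mem_cons, List.not_mem_nil, or_false, forall_eq_or_imp,
    forall_eq, Complex.ofReal_re, Complex.one_re, sub_self] at hc
  obtain ⟨⟨hcα, hcβ⟩, hc0⟩ := hc
  have hΓ0 : Complex.Gamma α * Complex.Gamma β ≠ 0 :=
    mul_ne_zero (Complex.Gamma_ne_zero_of_re_pos (by simpa))
      (Complex.Gamma_ne_zero_of_re_pos (by simpa))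
  set μ := gammaGammaMeasure α β
  set f : ℝ → ℂ := fun x => ((μ.real (Iic x) : ℝ) : ℂ) with hf
  have hs_re : ∀ t : ℝ, ((c : ℂ) + t * Complex.I).re = c := by simp
  have hs_ne : ∀ t : ℝ, ((c : ℂ) + t * Complex.I) ≠ 0 := fun t h => by
    have := hs_re t
    rw [h] at this
    simp at this
    linarith
  have hmellin : ∀ t : ℝ, MellinConvergent f (-(c + t * Complex.I)) ∧
      mellin f (-(c + t * Complex.I)) = ((α * β : ℝ) : ℂ) ^ ((c : ℂ) + t * Complex.I) *
        (Complex.Gamma (α - (c + t * Complex.I)) * Complex.Gamma (β - (c + t * Complex.I)) /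
          (c + t * Complex.I)) / (Complex.Gamma α * Complex.Gamma β) := by
    intro t
    obtain ⟨h1, h2⟩ := moment_gammaGammaMeasure hα hβ (s := c + t * Complex.I)
      (by rwa [hs_re]) (by rwa [hs_re])
    obtain ⟨h3, h4⟩ := mellin_cdf μ ae_gammaGammaMeasure_pos (by rwa [hs_re]) h1
    refine ⟨h3, ?_⟩
    rw [h4, h2]
    ring
  have hconv : MellinConvergent f ((-c : ℝ) : ℂ) := by simpa using (hmellin 0).1
  have hline : ∀ t : ℝ, (((-c : ℝ) : ℂ) + ((-t : ℝ) : ℂ) * Complex.I) = -(c + t * Complex.I) := by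
    intro t; push_cast; ring
  have hvert : Complex.VerticalIntegrable (mellin f) (-c) := by
    suffices Integrable fun t : ℝ => mellin f (((-c : ℝ) : ℂ) + ((-t : ℝ) : ℂ) * Complex.I) by
      have h := this.comp_neg
      simp only [neg_neg] at h
      exact h
    simp_rw [hline, fun t => (hmellin t).2]
    refine Integrable.div_const ?_ _
    refine (integrable_Gamma_mul_Gamma_div hc0 hcα hcβ).bdd_mul (c := (α * β) ^ c) ?_
      (ae_of_all _ fun t => ?_)
    · refine Continuous.aestronglyMeasurable ?_
      refine Continuous.const_cpow (by fun_prop) (Or.inl ?_)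
      exact_mod_cast hr.ne'
    · rw [Complex.norm_cpow_eq_rpow_re_of_pos hr, hs_re]
  have hcont : ContinuousAt f x :=
    (Complex.continuous_ofReal.comp (continuous_measureReal_Iic μ)).continuousAt
  have key := mellinInv_mellin_eq (-c) f hx hconv hvert hcont
  change _ = f x
  rw [← key, mellinInv]
  -- Inversion runs over `-c + it`, the Meijer integral over `s = c + it`; reversing `t` turns the
  -- first into `-s`.
  conv_rhs => rw [← integral_neg_eq_self]
  simp_rw [hline, fun t => (hmellin t).2]
  rw [mul_left_comm, Complex.real_smul, ← integral_const_mul]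
  congr 1
  · push_cast; rfl
  · congr 1
    ext t
    have hz : ((α * β * x : ℝ) : ℂ) ^ ((c : ℂ) + t * Complex.I) =
        ((α * β : ℝ) : ℂ) ^ ((c : ℂ) + t * Complex.I) * (x : ℂ) ^ ((c : ℂ) + t * Complex.I) := by
      rw [Complex.ofReal_mul (α * β), Complex.mul_cpow_ofReal_nonneg hr.le hx.le]
    have hg : Complex.Gamma (1 - 0 + ((c : ℂ) + t * Complex.I)) =
        ((c : ℂ) + t * Complex.I) * Complex.Gamma ((c : ℂ) + t * Complex.I) := by
      rw [← Complex.Gamma_add_one _ (hs_ne t)]; congr 1; ring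
    have hg0 : Complex.Gamma ((c : ℂ) + t * Complex.I) ≠ 0 :=
      Complex.Gamma_ne_zero_of_re_pos (by rwa [hs_re])
    have hs0 := hs_ne t
    simp only [meijerIntegrand, List.map_cons, List.map_nil, List.prod_cons, List.prod_nil,
      mul_one, hg, neg_neg, smul_eq_mul, hz, sub_self, zero_add]
    field_simp

end FSO

/-! ### The σ-algebra generated by a subfamily of random variables -/

/-- The σ-algebra generated by the members of the family `f` with index in `A`. -/
abbrev familySigma {K Ω : Type*} (f : K → Ω → ℝ) (A : Set K) : MeasurableSpace Ω :=
  ⨆ k ∈ A, MeasurableSpace.comap (f k) inferInstance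

section familySigma

variable {K Ω : Type*} {f : K → Ω → ℝ} {A B : Set K}

theorem measurable_familySigma {k : K} (hk : k ∈ A) : Measurable[familySigma f A] (f k) :=
  (comap_measurable (f k)).mono
    (le_iSup₂ (f := fun k (_ : k ∈ A) => MeasurableSpace.comap (f k) inferInstance) k hk) le_rfl

theorem familySigma_le {m : MeasurableSpace Ω} (hf : ∀ k, Measurable[m] (f k)) :
    familySigma f A ≤ m :=
  iSup₂_le fun k _ => (hf k).comap_le

/-- Serves to separate past slots from the next one, and one path from the other. -/
theorem measureReal_inter_familySigma [MeasurableSpace Ω] {P : Measure Ω}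
    (hf : ∀ k, Measurable (f k)) (hindep : iIndepFun f P) (hAB : Disjoint A B) {s t : Set Ω}
    (hs : MeasurableSet[familySigma f A] s) (ht : MeasurableSet[familySigma f B] t) :
    P.real (s ∩ t) = P.real s * P.real t := by
  have h := indep_iSup_of_disjoint (fun k => (hf k).comap_le) hindep.iIndep hAB
  simp only [Measure.real, (Indep_iff _ _ P).1 h s t hs ht, ENNReal.toReal_mul]

end familySigma

theorem measureReal_eq_add_of_fin_two {Ω : Type*} [MeasurableSpace Ω] (P : Measure Ω)
    [IsFiniteMeasure P] {b : Ω → Fin 2} (hb : Measurable b) (s : Set Ω) :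
    P.real s = P.real (b ⁻¹' {0} ∩ s) + P.real (b ⁻¹' {1} ∩ s) := by
  rw [← measureReal_inter_add_sdiff (s := s) (hb (measurableSet_singleton 0)), inter_comm]
  congr 2
  ext ω
  simp only [Set.mem_sdiff, mem_preimage, mem_singleton_iff, mem_inter_iff]
  rw [and_comm]
  have : b ω = 1 ↔ ¬ b ω = 0 := by omega
  rw [this]

/-! ### Gamma-Gamma tails and path laws -/

namespace FSO

theorem gammaGammaMeasure_real_Ioi_pos {α β : ℝ} (hα : 0 < α) (hβ : 0 < β)
    [IsProbabilityMeasure (gammaGammaMeasure α β)] {a : ℝ} (ha : 0 < a) :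
    0 < (gammaGammaMeasure α β).real (Ioi a) :=
  ENNReal.toReal_pos ((gammaGammaMeasure_Ioc_pos hα hβ ha.le (lt_add_one a)).trans_le
    (measure_mono Ioc_subset_Ioi_self)).ne' (measure_ne_top _ _)

theorem gammaGammaMeasure_real_Ioi_lt_one {α β : ℝ} (hα : 0 < α) (hβ : 0 < β)
    [IsProbabilityMeasure (gammaGammaMeasure α β)] {a : ℝ} (ha : 0 < a) :
    (gammaGammaMeasure α β).real (Ioi a) < 1 := by
  rw [← compl_Iic, probReal_compl_eq_one_sub measurableSet_Iic]
  have : 0 < (gammaGammaMeasure α β).real (Iic a) :=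
    ENNReal.toReal_pos ((gammaGammaMeasure_Ioc_pos hα hβ le_rfl ha).trans_le
      (measure_mono Ioc_subset_Iic_self)).ne' (measure_ne_top _ _)
  linarith

namespace System

variable (S : System)

/-! ### The law of a path -/

/-- The fading coefficient at which the weighted gain of a link equals `x`. -/
noncomputable def linkLevel (i : Fin 2) (l : Hop) (x : ℝ) : ℝ := x / (S.hbar i l * S.ρ i l)

/-- The cdf of the min equivalent channel gain of a path. -/
noncomputable def pathCDF (i : Fin 2) (x : ℝ) : ℝ :=
  1 - (gammaGammaMeasure (S.α i Hop.SR) (S.β i Hop.SR)).real (Ioi (S.linkLevel i Hop.SR x)) *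
    (gammaGammaMeasure (S.α i Hop.RD) (S.β i Hop.RD)).real (Ioi (S.linkLevel i Hop.RD x))

/-- The min equivalent channel gain at which the min equivalent SNR is `y`. -/
noncomputable def gainLevel (y : ℝ) : ℝ := √(S.N0 * y) / (S.η * S.Tb * S.Pt)

theorem linkLevel_pos (i : Fin 2) (l : Hop) {x : ℝ} (hx : 0 < x) : 0 < S.linkLevel i l x :=
  div_pos hx (mul_pos (S.hbar_pos i l) (S.ρ_pos i l))

theorem amplitude_pos : 0 < S.η * S.Tb * S.Pt :=
  mul_pos (mul_pos S.η_pos S.Tb_pos) S.Pt_pos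

theorem gainLevel_pos {y : ℝ} (hy : 0 < y) : 0 < S.gainLevel y :=
  div_pos (Real.sqrt_pos.2 (mul_pos S.N0_pos hy)) S.amplitude_pos

theorem one_div_Tbar (T : ℝ) : 1 / S.Tbar T = S.gainLevel T := by
  rw [Tbar, one_div_div, gainLevel]

theorem one_div_powerMargin : 1 / S.powerMargin = S.gainLevel S.γth := by
  rw [powerMargin, one_div_div, gainLevel]

theorem Tbar_le_powerMargin_iff {T : ℝ} (hT : 0 < T) : S.Tbar T ≤ S.powerMargin ↔ S.γth ≤ T := by
  rw [Tbar, powerMargin, div_le_div_iff_of_pos_left S.amplitude_pos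
    (Real.sqrt_pos.2 (mul_pos S.N0_pos hT)) (Real.sqrt_pos.2 (mul_pos S.N0_pos S.γth_pos)),
    Real.sqrt_le_sqrt_iff (mul_pos S.N0_pos hT).le, mul_le_mul_iff_right₀ S.N0_pos]

theorem gain_le_iff (i : Fin 2) (l : Hop) (x u : ℝ) :
    S.ρ i l * (S.hbar i l * u) ≤ x ↔ u ≤ S.linkLevel i l x := by
  rw [linkLevel, le_div_iff₀ (mul_pos (S.hbar_pos i l) (S.ρ_pos i l))]
  ring_nf

theorem pathCDF_pos [∀ i l, IsProbabilityMeasure (gammaGammaMeasure (S.α i l) (S.β i l))]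
    (i : Fin 2) {x : ℝ} (hx : 0 < x) : 0 < S.pathCDF i x := by
  have h := fun l => gammaGammaMeasure_real_Ioi_lt_one (S.α_pos i l) (S.β_pos i l)
    (S.linkLevel_pos i l hx)
  have h' := fun l => gammaGammaMeasure_real_Ioi_pos (S.α_pos i l) (S.β_pos i l)
    (S.linkLevel_pos i l hx)
  rw [pathCDF, sub_pos]
  exact mul_lt_one_of_nonneg_of_lt_one_left (h' _).le (h _) (h _).le

theorem pathCDF_lt_one [∀ i l, IsProbabilityMeasure (gammaGammaMeasure (S.α i l) (S.β i l))]
    (i : Fin 2) {x : ℝ} (hx : 0 < x) : S.pathCDF i x < 1 := by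
  have h' := fun l => gammaGammaMeasure_real_Ioi_pos (S.α_pos i l) (S.β_pos i l)
    (S.linkLevel_pos i l hx)
  rw [pathCDF]
  linarith [mul_pos (h' Hop.SR) (h' Hop.RD)]

theorem F_eq_pathCDF [∀ i l, IsProbabilityMeasure (gammaGammaMeasure (S.α i l) (S.β i l))]
    (i : Fin 2) {x : ℝ} (hx : 0 < x) : S.F i x = ((S.pathCDF i x : ℝ) : ℂ) := by
  have h : ∀ l, 1 - meijerCDF (S.α i l) (S.β i l) (S.α i l * S.β i l / (S.hbar i l * S.ρ i l) * x) =
      (((gammaGammaMeasure (S.α i l) (S.β i l)).real (Ioi (S.linkLevel i l x)) : ℝ) : ℂ) := by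
    intro l
    rw [← compl_Iic, probReal_compl_eq_one_sub measurableSet_Iic, div_mul_eq_mul_div, mul_div_assoc]
    push_cast
    rw [← meijerCDF_eq (S.α_pos i l) (S.β_pos i l) (S.linkLevel_pos i l hx)]
    rfl
  rw [F, h, h, pathCDF]
  push_cast
  rfl

/-- The SNR is the square of a multiple of the gain, so nonnegative fading is needed to take roots.
-/
theorem linkSNR_lt_iff (i : Fin 2) (l : Hop) {u y : ℝ} (hu : 0 ≤ u) :
    S.linkSNR i l u < y ↔ S.ρ i l * (S.hbar i l * u) < S.gainLevel y := by
  have hg : 0 ≤ S.ρ i l * (S.hbar i l * u) :=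
    mul_nonneg (S.ρ_pos i l).le (mul_nonneg (S.hbar_pos i l).le hu)
  rw [linkSNR, div_lt_iff₀ S.N0_pos, gainLevel, lt_div_iff₀ S.amplitude_pos,
    Real.lt_sqrt (mul_nonneg hg S.amplitude_pos.le)]
  ring_nf

theorem minSNR_lt_iff (i : Fin 2) {x : Hop → ℝ} (hx : ∀ l, 0 ≤ x l) {y : ℝ} :
    S.minSNR i x < y ↔ S.minGain i x < S.gainLevel y := by
  rw [minSNR, minGain, min_lt_iff, min_lt_iff, S.linkSNR_lt_iff i _ (hx _),
    S.linkSNR_lt_iff i _ (hx _)]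

theorem measurable_minSNR {Ω : Type*} {m : MeasurableSpace Ω} (i : Fin 2) {x : Hop → Ω → ℝ}
    (hx : ∀ l, Measurable (x l)) : Measurable fun ω => S.minSNR i (fun l => x l ω) := by
  have := hx Hop.SR
  have := hx Hop.RD
  unfold minSNR linkSNR
  fun_prop

/-- The σ-algebra is arbitrary and only slots up to `j` are constrained, so that it applies to the
σ-algebra of the past. -/
theorem measurable_active {Ω : Type*} {m : MeasurableSpace Ω} (T : ℝ) {b₀ : Ω → Fin 2}
    (hb₀ : Measurable b₀) {h : Fin 2 → Hop → ℕ → Ω → ℝ} {j : ℕ}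
    (hmeas : ∀ i l, ∀ k ≤ j, Measurable (h i l k)) :
    Measurable fun ω => S.active T (b₀ ω) (fun i l k => h i l k ω) j := by
  induction j with
  | zero => exact hb₀
  | succ j ih =>
    have hstay : ∀ i, MeasurableSet {ω | T ≤ S.minSNR i (fun l => h i l (j + 1) ω)} := fun i =>
      measurableSet_le measurable_const
        (S.measurable_minSNR i fun l => hmeas i l (j + 1) le_rfl)
    have hj := ih fun i l k hk => hmeas i l k (hk.trans j.le_succ)
    exact Measurable.ite (hj (measurableSet_singleton 0))
      (Measurable.ite (hstay 0) measurable_const measurable_const)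
      (Measurable.ite (hstay 1) measurable_const measurable_const)

section Probability

variable {Ω : Type*} [MeasurableSpace Ω] {P : Measure Ω} [IsProbabilityMeasure P]
  {h : Fin 2 → Hop → ℕ → Ω → ℝ}

theorem measureReal_minGain_le (hmeas : ∀ i l j, Measurable (h i l j))
    (hlaw : ∀ i l j, P.map (h i l j) = gammaGammaMeasure (S.α i l) (S.β i l))
    (hindep : iIndepFun (fun (k : Fin 2 × Hop × ℕ) => h k.1 k.2.1 k.2.2) P)
    (i : Fin 2) (j : ℕ) (x : ℝ) :
    P.real {ω | S.minGain i (fun l => h i l j ω) ≤ x} = S.pathCDF i x := by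
  have hset : {ω | S.minGain i (fun l => h i l j ω) ≤ x} =
      (h i Hop.SR j ⁻¹' Ioi (S.linkLevel i Hop.SR x) ∩
        h i Hop.RD j ⁻¹' Ioi (S.linkLevel i Hop.RD x))ᶜ := by
    ext ω
    simp only [minGain, mem_ofPred_eq, min_le_iff, gain_le_iff, mem_compl_iff, mem_inter_iff,
      mem_preimage, mem_Ioi, not_and_or, not_lt]
  have hlink : ∀ l, P.real (h i l j ⁻¹' Ioi (S.linkLevel i l x)) =
      (gammaGammaMeasure (S.α i l) (S.β i l)).real (Ioi (S.linkLevel i l x)) := by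
    intro l
    rw [← hlaw i l j, map_measureReal_apply (hmeas i l j) measurableSet_Ioi]
  have hI : IndepFun (h i Hop.SR j) (h i Hop.RD j) P :=
    hindep.indepFun (i := (i, Hop.SR, j)) (j := (i, Hop.RD, j)) (by simp)
  rw [hset, probReal_compl_eq_one_sub
    ((hmeas _ _ _ measurableSet_Ioi).inter (hmeas _ _ _ measurableSet_Ioi)), pathCDF,
    ← hlink, ← hlink]
  simp only [Measure.real, hI.measure_inter_preimage_eq_mul _ _ measurableSet_Ioi measurableSet_Ioi,
    ENNReal.toReal_mul]

/-- Outage is a strict inequality and a cdf a weak one; they agree almost surely because the fading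
has no atoms. -/
theorem measureReal_minSNR_lt (hmeas : ∀ i l j, Measurable (h i l j))
    (hlaw : ∀ i l j, P.map (h i l j) = gammaGammaMeasure (S.α i l) (S.β i l))
    (hindep : iIndepFun (fun (k : Fin 2 × Hop × ℕ) => h k.1 k.2.1 k.2.2) P)
    (i : Fin 2) (j : ℕ) (y : ℝ) :
    P.real {ω | S.minSNR i (fun l => h i l j ω) < y} = S.pathCDF i (S.gainLevel y) := by
  rw [← S.measureReal_minGain_le hmeas hlaw hindep i j]
  have hpos : ∀ l, ∀ᵐ ω ∂P, 0 < h i l j ω := fun l =>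
    ae_of_ae_map (hmeas i l j).aemeasurable (by rw [hlaw]; exact ae_gammaGammaMeasure_pos)
  have hne : ∀ l, ∀ᵐ ω ∂P, S.ρ i l * (S.hbar i l * h i l j ω) ≠ S.gainLevel y := by
    intro l
    have h0 : ∀ᵐ u ∂(P.map (h i l j)), u ≠ S.linkLevel i l (S.gainLevel y) := by
      rw [hlaw]
      exact measure_eq_zero_iff_ae_notMem.1 (measure_singleton _)
    filter_upwards [ae_of_ae_map (hmeas i l j).aemeasurable h0] with ω hω heq
    apply hω
    rw [linkLevel, eq_div_iff (mul_pos (S.hbar_pos i l) (S.ρ_pos i l)).ne', ← heq]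
    ring
  refine measureReal_congr ?_
  filter_upwards [hpos Hop.SR, hpos Hop.RD, hne Hop.SR, hne Hop.RD] with ω h1 h2 h3 h4
  refine propext ?_
  change S.minSNR i (fun l => h i l j ω) < y ↔ S.minGain i (fun l => h i l j ω) ≤ S.gainLevel y
  rw [S.minSNR_lt_iff i (fun l => by cases l <;> [exact h1.le; exact h2.le]), minGain,
    min_lt_iff, min_le_iff, h3.le_iff_lt, h4.le_iff_lt]

/-! ### The selection process -/

theorem measureReal_active_inter (T : ℝ) {b₀ : Ω → Fin 2} (hb₀ : Measurable b₀)
    (hmeas : ∀ i l j, Measurable (h i l j))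
    (hindep : iIndepFun (fun (k : Fin 2 × Hop × ℕ) => h k.1 k.2.1 k.2.2) P)
    (hindep₀ : IndepFun b₀ (fun ω i l j => h i l j ω) P) (j : ℕ) (b : Fin 2) {s : Set Ω}
    (hs : MeasurableSet[familySigma (fun (k : Fin 2 × Hop × ℕ) => h k.1 k.2.1 k.2.2)
      {k | k.2.2 = j + 1}] s) :
    P.real ({ω | S.active T (b₀ ω) (fun i l k => h i l k ω) j = b} ∩ s) =
      P.real {ω | S.active T (b₀ ω) (fun i l k => h i l k ω) j = b} * P.real s := by
  set f : Fin 2 × Hop × ℕ → Ω → ℝ := fun k => h k.1 k.2.1 k.2.2 with hf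
  have hfmeas : ∀ k, Measurable (f k) := fun k => hmeas _ _ _
  -- With the initial relay frozen at `c`, the event depends on past fading alone; averaging over
  -- the independent `b₀` then recovers the random start.
  set A : Fin 2 → Set Ω := fun c => {ω | S.active T c (fun i l k => h i l k ω) j = b} with hA
  have hAm : ∀ c, MeasurableSet[familySigma f {k | k.2.2 ≤ j}] (A c) := by
    intro c
    exact S.measurable_active (m := familySigma f {k | k.2.2 ≤ j}) T
      (b₀ := fun _ => c) measurable_const
      (fun i l k hk => measurable_familySigma (f := f) (k := (i, l, k)) hk)
      (measurableSet_singleton b)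
  have hdisj : Disjoint {k : Fin 2 × Hop × ℕ | k.2.2 ≤ j} {k | k.2.2 = j + 1} :=
    Set.disjoint_left.2 fun k (h1 : k.2.2 ≤ j) (h2 : k.2.2 = j + 1) => by omega
  have hle : ∀ B : Set (Fin 2 × Hop × ℕ), familySigma f B ≤
      MeasurableSpace.comap (fun ω i l j => h i l j ω) inferInstance := by
    intro B
    refine familySigma_le fun k => ?_
    have hev : Measurable fun x : Fin 2 → Hop → ℕ → ℝ => x k.1 k.2.1 k.2.2 := by fun_prop
    exact hev.comp (comap_measurable _)
  have hsplit : ∀ c {t : Set Ω},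
      MeasurableSet[MeasurableSpace.comap (fun ω i l j => h i l j ω) inferInstance] t →
      P.real (b₀ ⁻¹' {c} ∩ t) = P.real (b₀ ⁻¹' {c}) * P.real t := by
    intro c t ht
    have := (IndepFun_iff _ _ P).1 hindep₀ (b₀ ⁻¹' {c}) t ⟨{c}, measurableSet_singleton c, rfl⟩ ht
    simp only [Measure.real, this, ENNReal.toReal_mul]
  have hcase : ∀ c t, b₀ ⁻¹' {c} ∩
      ({ω | S.active T (b₀ ω) (fun i l k => h i l k ω) j = b} ∩ t) = b₀ ⁻¹' {c} ∩ (A c ∩ t) := by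
    intro c t
    ext ω
    simp only [mem_inter_iff, mem_preimage, mem_singleton_iff, mem_ofPred_eq, hA]
    constructor <;> rintro ⟨rfl, h1, h2⟩ <;> exact ⟨rfl, h1, h2⟩
  have hprob : ∀ t, MeasurableSet[MeasurableSpace.comap (fun ω i l j => h i l j ω) inferInstance] t →
      P.real ({ω | S.active T (b₀ ω) (fun i l k => h i l k ω) j = b} ∩ t) =
        P.real (b₀ ⁻¹' {0}) * P.real (A 0 ∩ t) + P.real (b₀ ⁻¹' {1}) * P.real (A 1 ∩ t) := by
    intro t ht
    rw [measureReal_eq_add_of_fin_two P hb₀, hcase, hcase,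
      hsplit 0 (MeasurableSet.inter (hle _ _ (hAm 0)) ht),
      hsplit 1 (MeasurableSet.inter (hle _ _ (hAm 1)) ht)]
  have huniv := hprob univ MeasurableSet.univ
  simp only [inter_univ] at huniv
  rw [hprob s (hle _ _ hs), huniv, measureReal_inter_familySigma hfmeas hindep hdisj (hAm 0) hs,
    measureReal_inter_familySigma hfmeas hindep hdisj (hAm 1) hs]
  ring

end Probability

end System

end FSO

/-! ### One-step transitions and outage -/

namespace FSO
namespace System

variable (S : System)

/-- The outage probability contributed by relay `i` being active in the previous slot. -/
noncomputable def outageFrom (T : ℝ) (i i' : Fin 2) : ℝ :=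
  max (S.pathCDF i (S.gainLevel S.γth) - S.pathCDF i (S.gainLevel T)) 0 +
    S.pathCDF i (S.gainLevel T) * S.pathCDF i' (S.gainLevel S.γth)

theorem pathCDF_gainLevel_mono
    [∀ i l, IsProbabilityMeasure (gammaGammaMeasure (S.α i l) (S.β i l))] (i : Fin 2) :
    Monotone fun y => S.pathCDF i (S.gainLevel y) := by
  intro y y' hy
  have hg : S.gainLevel y ≤ S.gainLevel y' := by
    refine div_le_div_of_nonneg_right (Real.sqrt_le_sqrt ?_) S.amplitude_pos.le
    exact mul_le_mul_of_nonneg_left hy S.N0_pos.le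
  have hl : ∀ l, (gammaGammaMeasure (S.α i l) (S.β i l)).real
      (Ioi (S.linkLevel i l (S.gainLevel y'))) ≤
      (gammaGammaMeasure (S.α i l) (S.β i l)).real (Ioi (S.linkLevel i l (S.gainLevel y))) :=
    fun l => measureReal_mono (Ioi_subset_Ioi (div_le_div_of_nonneg_right hg
      (mul_pos (S.hbar_pos i l) (S.ρ_pos i l)).le))
  simp only [pathCDF]
  exact sub_le_sub_left (mul_le_mul (hl _) (hl _) measureReal_nonneg measureReal_nonneg) 1

/-- The probability that the first relay is active in the steady state. -/
noncomputable def steadyProb (T : ℝ) : ℝ :=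
  S.pathCDF 1 (S.gainLevel T) / (S.pathCDF 0 (S.gainLevel T) + S.pathCDF 1 (S.gainLevel T))

/-- The order of `Tbar T` and `powerMargin` is that of `γth` and `T`, so the two branches of the
formula are the two values of the `max` in `outageFrom`. -/
theorem outageFormula_eq [∀ i l, IsProbabilityMeasure (gammaGammaMeasure (S.α i l) (S.β i l))]
    {T : ℝ} (hT : 0 < T) :
    S.outageFormula T = ((S.steadyProb T * S.outageFrom T 0 1 +
      (1 - S.steadyProb T) * S.outageFrom T 1 0 : ℝ) : ℂ) := by
  have hp := fun i => S.pathCDF_pos i (S.gainLevel_pos hT)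
  have hmono := fun i => S.pathCDF_gainLevel_mono i
  have hsum : (S.pathCDF 0 (S.gainLevel T) + S.pathCDF 1 (S.gainLevel T)) ≠ 0 :=
    (add_pos (hp 0) (hp 1)).ne'
  rw [outageFormula, one_div_Tbar, one_div_powerMargin]
  simp only [S.Tbar_le_powerMargin_iff hT, S.F_eq_pathCDF _ (S.gainLevel_pos hT), S.F_eq_pathCDF _ (S.gainLevel_pos S.γth_pos)]
  rw [outageFrom, outageFrom, steadyProb]
  split_ifs with hle
  · rw [max_eq_right (sub_nonpos.2 (hmono 0 hle)), max_eq_right (sub_nonpos.2 (hmono 1 hle))]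
    norm_cast
    field_simp
    ring
  · have hle' := (not_le.1 hle).le
    rw [max_eq_left (sub_nonneg.2 (hmono 0 hle')), max_eq_left (sub_nonneg.2 (hmono 1 hle'))]
    norm_cast
    field_simp
    ring

theorem measurableSet_minSNR_lt {Ω : Type*} {h : Fin 2 → Hop → ℕ → Ω → ℝ} (i : Fin 2) (j : ℕ) (y : ℝ) {A : Set (Fin 2 × Hop × ℕ)}
    (hA : ∀ l, (i, l, j) ∈ A) :
    MeasurableSet[familySigma (fun (k : Fin 2 × Hop × ℕ) => h k.1 k.2.1 k.2.2) A]
      {ω | S.minSNR i (fun l => h i l j ω) < y} :=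
  S.measurable_minSNR (m := familySigma (fun (k : Fin 2 × Hop × ℕ) => h k.1 k.2.1 k.2.2) A) i
    (fun l => measurable_familySigma (f := fun (k : Fin 2 × Hop × ℕ) => h k.1 k.2.1 k.2.2)
      (hA l)) measurableSet_Iio

section Probability

variable {Ω : Type*} [MeasurableSpace Ω] {P : Measure Ω} [IsProbabilityMeasure P]
  {h : Fin 2 → Hop → ℕ → Ω → ℝ}

/-- Disjoint cases: the relay stays but lies below `γth`, or it is left and the other path,
independent of it, lies below `γth`. -/
theorem measureReal_outageFrom (T : ℝ) (hmeas : ∀ i l j, Measurable (h i l j))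
    (hlaw : ∀ i l j, P.map (h i l j) = gammaGammaMeasure (S.α i l) (S.β i l))
    (hindep : iIndepFun (fun (k : Fin 2 × Hop × ℕ) => h k.1 k.2.1 k.2.2) P)
    {i i' : Fin 2} (hi : i ≠ i') (j : ℕ) :
    P.real (({ω | S.minSNR i (fun l => h i l j ω) < S.γth} \
        {ω | S.minSNR i (fun l => h i l j ω) < T}) ∪
      ({ω | S.minSNR i (fun l => h i l j ω) < T} ∩
        {ω | S.minSNR i' (fun l => h i' l j ω) < S.γth})) = S.outageFrom T i i' := by
  have hm : ∀ i y, MeasurableSet {ω | S.minSNR i (fun l => h i l j ω) < y} := fun i y =>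
    measurableSet_lt (S.measurable_minSNR i fun l => hmeas i l j) measurable_const
  have hlaw' := S.measureReal_minSNR_lt hmeas hlaw hindep
  rw [measureReal_union (disjoint_sdiff_left.mono_right inter_subset_left) ((hm _ _).inter (hm _ _)),
    outageFrom]
  congr 1
  · rcases le_total T S.γth with hT | hT
    · have hsub : {ω | S.minSNR i (fun l => h i l j ω) < T} ⊆
          {ω | S.minSNR i (fun l => h i l j ω) < S.γth} := fun ω hω => lt_of_lt_of_le hω hT
      rw [measureReal_sdiff hsub (hm _ _), hlaw', hlaw', max_eq_left]
      rw [← hlaw' i j, ← hlaw' i j, sub_nonneg]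
      exact measureReal_mono hsub
    · have hsub : {ω | S.minSNR i (fun l => h i l j ω) < S.γth} ⊆
          {ω | S.minSNR i (fun l => h i l j ω) < T} := fun ω hω => lt_of_lt_of_le hω hT
      rw [sdiff_eq_empty.2 hsub, measureReal_empty, max_eq_right]
      rw [← hlaw' i j, ← hlaw' i j, sub_nonpos]
      exact measureReal_mono hsub
  · have hdisj : Disjoint {k : Fin 2 × Hop × ℕ | k.1 = i} {k | k.1 = i'} :=
      Set.disjoint_left.2 fun k (h1 : k.1 = i) (h2 : k.1 = i') => hi (h1.symm.trans h2)
    rw [measureReal_inter_familySigma (f := fun (k : Fin 2 × Hop × ℕ) => h k.1 k.2.1 k.2.2)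
      (fun k => hmeas k.1 k.2.1 k.2.2) hindep hdisj
      (S.measurableSet_minSNR_lt i j T fun _ => rfl)
      (S.measurableSet_minSNR_lt i' j S.γth fun _ => rfl), hlaw', hlaw']

theorem measureReal_active_eq_one (T : ℝ) {b₀ : Ω → Fin 2} (hb₀ : Measurable b₀)
    (hmeas : ∀ i l j, Measurable (h i l j)) (j : ℕ) :
    P.real {ω | S.active T (b₀ ω) (fun i l k => h i l k ω) j = 1} =
      1 - P.real {ω | S.active T (b₀ ω) (fun i l k => h i l k ω) j = 0} := by
  have hb := S.measurable_active T hb₀ (h := h) (j := j) fun i l k _ => hmeas i l k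
  have h0 : MeasurableSet {ω | S.active T (b₀ ω) (fun i l k => h i l k ω) j = 0} :=
    hb (measurableSet_singleton 0)
  rw [← probReal_compl_eq_one_sub h0]
  congr 1
  ext ω
  simp only [mem_ofPred_eq, mem_compl_iff]
  omega

theorem measureReal_active_succ (T : ℝ) {b₀ : Ω → Fin 2} (hb₀ : Measurable b₀)
    (hmeas : ∀ i l j, Measurable (h i l j))
    (hlaw : ∀ i l j, P.map (h i l j) = gammaGammaMeasure (S.α i l) (S.β i l))
    (hindep : iIndepFun (fun (k : Fin 2 × Hop × ℕ) => h k.1 k.2.1 k.2.2) P)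
    (hindep₀ : IndepFun b₀ (fun ω i l j => h i l j ω) P) (j : ℕ) :
    P.real {ω | S.active T (b₀ ω) (fun i l k => h i l k ω) (j + 1) = 0} =
      P.real {ω | S.active T (b₀ ω) (fun i l k => h i l k ω) j = 0} *
          (1 - S.pathCDF 0 (S.gainLevel T)) +
        (1 - P.real {ω | S.active T (b₀ ω) (fun i l k => h i l k ω) j = 0}) *
          S.pathCDF 1 (S.gainLevel T) := by
  have hb := S.measurable_active T hb₀ (h := h) (j := j) fun i l k _ => hmeas i l k
  have hlt := fun i => S.measurableSet_minSNR_lt (h := h) i (j + 1) T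
    (A := {k | k.2.2 = j + 1}) fun _ => rfl
  have hm : MeasurableSet {ω | S.minSNR 0 (fun l => h 0 l (j + 1) ω) < T} :=
    measurableSet_lt (S.measurable_minSNR 0 fun l => hmeas 0 l _) measurable_const
  rw [← S.measureReal_active_eq_one T hb₀ hmeas,
    ← S.measureReal_minSNR_lt hmeas hlaw hindep 0 (j + 1) T, ← probReal_compl_eq_one_sub hm,
    ← S.measureReal_minSNR_lt hmeas hlaw hindep 1 (j + 1) T,
    ← S.measureReal_active_inter T hb₀ hmeas hindep hindep₀ j 0 (hlt 0).compl,
    ← S.measureReal_active_inter T hb₀ hmeas hindep hindep₀ j 1 (hlt 1),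
    measureReal_eq_add_of_fin_two P hb]
  congr 2
  · ext ω
    simp only [mem_inter_iff, mem_preimage, mem_singleton_iff, mem_ofPred_eq, mem_compl_iff, not_lt]
    refine and_congr_right fun h0 => ?_
    rw [active, if_pos h0]
    split_ifs with h1 <;> simp [h1]
  · ext ω
    simp only [mem_inter_iff, mem_preimage, mem_singleton_iff, mem_ofPred_eq]
    refine and_congr_right fun h0 => ?_
    rw [active, if_neg (by rw [h0]; decide)]
    split_ifs with h1
    · simp [h1]
    · simpa using h1

theorem outageProb_succ (T : ℝ) {b₀ : Ω → Fin 2} (hb₀ : Measurable b₀)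
    (hmeas : ∀ i l j, Measurable (h i l j))
    (hlaw : ∀ i l j, P.map (h i l j) = gammaGammaMeasure (S.α i l) (S.β i l))
    (hindep : iIndepFun (fun (k : Fin 2 × Hop × ℕ) => h k.1 k.2.1 k.2.2) P)
    (hindep₀ : IndepFun b₀ (fun ω i l j => h i l j ω) P) (j : ℕ) :
    S.outageProb P T b₀ h (j + 1) =
      P.real {ω | S.active T (b₀ ω) (fun i l k => h i l k ω) j = 0} * S.outageFrom T 0 1 +
        (1 - P.real {ω | S.active T (b₀ ω) (fun i l k => h i l k ω) j = 0}) *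
          S.outageFrom T 1 0 := by
  have hb := S.measurable_active T hb₀ (h := h) (j := j) fun i l k _ => hmeas i l k
  have hlt := fun i y => S.measurableSet_minSNR_lt (h := h) i (j + 1) y
    (A := {k | k.2.2 = j + 1}) fun _ => rfl
  have hE := fun i i' => MeasurableSet.union (MeasurableSet.diff (hlt i S.γth) (hlt i T))
    (MeasurableSet.inter (hlt i T) (hlt i' S.γth))
  rw [← S.measureReal_active_eq_one T hb₀ hmeas,
    ← S.measureReal_outageFrom T hmeas hlaw hindep zero_ne_one (j + 1),
    ← S.measureReal_outageFrom T hmeas hlaw hindep one_ne_zero (j + 1),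
    ← S.measureReal_active_inter T hb₀ hmeas hindep hindep₀ j 0 (hE 0 1),
    ← S.measureReal_active_inter T hb₀ hmeas hindep hindep₀ j 1 (hE 1 0),
    outageProb, measureReal_eq_add_of_fin_two P hb]
  congr 2
  · ext ω
    simp only [mem_inter_iff, mem_preimage, mem_singleton_iff, mem_ofPred_eq, mem_union, Set.mem_sdiff]
    refine and_congr_right fun h0 => ?_
    rw [active, if_pos h0]
    split_ifs with h1
    · simp [not_lt.2 h1]
    · simp [not_le.1 h1]
  · ext ω
    simp only [mem_inter_iff, mem_preimage, mem_singleton_iff, mem_ofPred_eq, mem_union, Set.mem_sdiff]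
    refine and_congr_right fun h0 => ?_
    rw [active, if_neg (by rw [h0]; decide)]
    split_ifs with h1
    · simp [not_lt.2 h1]
    · simp [not_le.1 h1]

end Probability

end System

end FSO

/-! ### Fixed point and convergence -/

theorem theorem6 (S : FSO.System) (T : ℝ) (hT : 0 < T)
    {Ω : Type*} [MeasurableSpace Ω] (P : Measure Ω) [IsProbabilityMeasure P]
    -- the relay that is active before the first slot
    (b₀ : Ω → Fin 2) (hb₀ : Measurable b₀)
    -- the fading coefficient of hop `l` of path `i` in slot `j`
    (h : Fin 2 → FSO.Hop → ℕ → Ω → ℝ) (hmeas : ∀ i l j, Measurable (h i l j))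
    (hlaw : ∀ i l j, P.map (h i l j) = FSO.gammaGammaMeasure (S.α i l) (S.β i l))
    (hindep : iIndepFun (fun (k : Fin 2 × FSO.Hop × ℕ) => h k.1 k.2.1 k.2.2) P)
    (hindep₀ : IndepFun b₀ (fun ω i l j => h i l j ω) P) :
    -- `F i` is the cdf of the min equivalent channel gain of path `i`
    (∀ (i : Fin 2) (j : ℕ) (x : ℝ), 0 < x →
      ((P.real {ω | S.minGain i (fun l => h i l j ω) ≤ x} : ℝ) : ℂ) = S.F i x) ∧
    -- in the steady state of the selection process the outage probability is exactly the formula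
    (∀ j : ℕ,
      P.map (fun ω => S.active T (b₀ ω) (fun i l k => h i l k ω) (j + 1)) =
        P.map (fun ω => S.active T (b₀ ω) (fun i l k => h i l k ω) j) →
      ((S.outageProb P T b₀ h (j + 1) : ℝ) : ℂ) = S.outageFormula T) ∧
    -- and the steady state value is reached in the limit from any initial distribution
    Filter.Tendsto (fun j : ℕ => ((S.outageProb P T b₀ h j : ℝ) : ℂ)) Filter.atTop
      (nhds (S.outageFormula T))
 := by
  -- The Gamma-Gamma measure has total mass one because it is the law of a fading coefficient.
  have hprob : ∀ i l, IsProbabilityMeasure (FSO.gammaGammaMeasure (S.α i l) (S.β i l)) :=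
    fun i l => hlaw i l 0 ▸ Measure.isProbabilityMeasure_map (hmeas i l 0).aemeasurable
  set p : Fin 2 → ℝ := fun i => S.pathCDF i (S.gainLevel T) with hp
  have hp0 : ∀ i, 0 < p i := fun i => S.pathCDF_pos i (S.gainLevel_pos hT)
  have hp1 : ∀ i, p i < 1 := fun i => S.pathCDF_lt_one i (S.gainLevel_pos hT)
  have hsum : p 0 + p 1 ≠ 0 := (add_pos (hp0 0) (hp0 1)).ne'
  have hsteady : S.steadyProb T * (p 0 + p 1) = p 1 := div_mul_cancel₀ _ hsum
  set q : ℕ → ℝ := fun j => P.real {ω | S.active T (b₀ ω) (fun i l k => h i l k ω) j = 0} with hq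
  have hrec : ∀ j, q (j + 1) = q j * (1 - p 0) + (1 - q j) * p 1 :=
    S.measureReal_active_succ T hb₀ hmeas hlaw hindep hindep₀
  have hout : ∀ j, S.outageProb P T b₀ h (j + 1) =
      q j * S.outageFrom T 0 1 + (1 - q j) * S.outageFrom T 1 0 :=
    S.outageProb_succ T hb₀ hmeas hlaw hindep hindep₀
  refine ⟨fun i j x hx => ?_, fun j hj => ?_, ?_⟩
  · rw [S.F_eq_pathCDF i hx, S.measureReal_minGain_le hmeas hlaw hindep]
  · have hact : ∀ j, Measurable fun ω => S.active T (b₀ ω) (fun i l k => h i l k ω) j := fun j =>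
      S.measurable_active T hb₀ fun i l k _ => hmeas i l k
    have hqj : q (j + 1) = q j := by
      have := congrArg (fun μ : Measure (Fin 2) => μ.real {0}) hj
      simp only [map_measureReal_apply (hact _) (measurableSet_singleton 0)] at this
      exact this
    have hfix : q j = S.steadyProb T := by
      refine mul_right_cancel₀ hsum ?_
      rw [hsteady]
      linarith [hrec j]
    rw [S.outageFormula_eq hT, hout, hfix]
  · have hgeom : ∀ j, q j = S.steadyProb T + (1 - (p 0 + p 1)) ^ j * (q 0 - S.steadyProb T) := by
      intro j
      induction j with
      | zero => ring
      | succ j ih =>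
        rw [hrec, ih, pow_succ]
        linear_combination (-1 : ℝ) * hsteady
    have hlim : Tendsto q atTop (𝓝 (S.steadyProb T)) := by
      have habs : |1 - (p 0 + p 1)| < 1 := by
        rw [abs_lt]
        constructor <;> linarith [hp0 0, hp0 1, hp1 0, hp1 1]
      rw [funext hgeom]
      simpa using ((tendsto_pow_atTop_nhds_zero_of_abs_lt_one habs).mul_const
        (q 0 - S.steadyProb T)).const_add (S.steadyProb T)
    -- No switching decision precedes slot `0`, so the outage identity starts at slot `1`; the limit
    -- is insensitive to the shift.
    rw [← tendsto_add_atTop_iff_nat 1, S.outageFormula_eq hT]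
    simp_rw [hout]
    exact (Complex.continuous_ofReal.tendsto _).comp
      ((hlim.mul_const _).add ((hlim.const_sub 1).mul_const _))
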